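/- Let $\mathcal O$ be the ring of germs of holomorphic functions at a point $z\in\mathbb C^2$ with coordinates $(x,y)$. A $4$-web is presented by an equation $F(x,y,y')=0$, where $F=a_0p^4+a_1p^3+a_2p^2+a_3p+a_4\in\mathcal O[p]$ is such that the resultant of $F$ and $\partial_pF$ with respect to $p$ does not vanish at $z$. Its slopes are the roots $p_1,\dots,p_4\in\mathcal O$ of $F$. **Linearization polynomial.** There is a unique polynomial $P=l_1p^3+l_2p^2+l_3p+l_4\in\mathcal O[p]$ with $\partial_xp_i+p_i\,\partial_yp_i=P(x,y,p_i)$ for all $i$ (this is part of the statement). Put $$L_1=\partial_x(\partial_xl_2-2\partial_yl_3)-l_3(\partial_xl_2-2\partial_yl_3)+3\partial_y^2l_4-3\partial_y(l_2l_4)+3\partial_x(l_4l_1)+3l_4\partial_xl_1,$$ $$L_2=-\partial_y(2\partial_xl_2-\partial_yl_3)-l_2(2\partial_xl_2-\partial_yl_3)+3\partial_x^2l_1+3\partial_x(l_3l_1)-3\partial_y(l_4l_1)-3l_1\partial_yl_4 .$$ **Connection.** For $r=b_3p+b_4$ with $b_3,b_4\in\mathcal O$ there is a unique $t=t_2p^2+t_3p+t_4\in\mathcal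 O[p]$ such that, for some $r_p\in\mathcal O[p]$ of degree at most $3$, $$r\,(\partial_xF+p\,\partial_yF)+r_p\,\partial_pF=(\partial_xr+p\,\partial_yr+\partial_pr_p-t)\,F,$$ that is, $d\omega=t\,\frac{dx\wedge dy}{\partial_pF}$ on the surface $F=0$, where $\omega=r\,\frac{dy-p\,dx}{\partial_pF}$. The map $(b_3,b_4)\mapsto(t_4,t_3,t_2)$ is a linear differential operator of first order. Let $p_0:J_1(\mathcal O^2)\to\mathcal O^3$ be the associated morphism on $1$-jets, $p_1:J_2(\mathcal O^2)\to J_1(\mathcal O^3)$ its first prolongation, $R_0=\ker p_0$ and $E=\ker p_1$. The projection $\overline\pi_0:E\to R_0$ is an isomorphism, and $\nabla=\overline\pi_0^{-1}\circ D:E\to\Omega^1\otimes_{\mathcal O}E$, where $D$ is the Spencer operator, is the connection associated with the web. In a basis $b=(b_1,b_2,b_3)$ of $E$, its connection matrix $\gamma$ is given by $\nabla b_j=\sum_i\gamma_{ij}\otimes b_i$, and its curvature matrix is $d\gamma+\gamma\wedge\gamma$. **Theorem.** The $\mathcal O$-module $E$ has a basis $b=(b_1,b_2,b_3)$, whose elements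 have the $0$-jets $(0,0)$, $(-1,0)$, $(0,1)$ respectively, in which the curvature matrix of the connection is $$K=\begin{pmatrix}k_1&\partial_xk_1+L_1&\partial_yk_1+L_2\\0&0&0\\0&0&0\end{pmatrix}dx\wedge dy,\qquad\text{where } k_1\,dx\wedge dy=d(\operatorname{tr}\gamma).$$ Moreover the curvature is an $\mathcal O^*$-invariant of the web: for every invertible $g\in\mathcal O$, the multiplication of $2$-jets by (the $2$-jet of) $g$ is an isomorphism $\Phi$ from $E$ onto the module $E'$ constructed from the equation $gF=0$, and the curvature matrix of the connection of $E'$ in the basis $\Phi(b)$ is again $K$. -/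

import Mathlib

open Polynomial Filter Topology

/-! ## Germs of holomorphic functions of two variables -/

/-- The ring `𝒪` of germs at `z ∈ ℂ²` of holomorphic functions of the two variables `(x, y)`. -/
def HolGerm (z : ℂ × ℂ) : Subring (Germ (𝓝 z) ℂ) where
  carrier := {φ | ∃ f : ℂ × ℂ → ℂ, AnalyticAt ℂ f z ∧ (f : Germ (𝓝 z) ℂ) = φ}
  mul_mem' := by
    rintro _ _ ⟨f, hf, rfl⟩ ⟨g, hg, rfl⟩
    exact ⟨f * g, hf.mul hg, rfl⟩
  one_mem' := ⟨1, analyticAt_const, rfl⟩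
  add_mem' := by
    rintro _ _ ⟨f, hf, rfl⟩ ⟨g, hg, rfl⟩
    exact ⟨f + g, hf.add hg, rfl⟩
  zero_mem' := ⟨0, analyticAt_const, rfl⟩
  neg_mem' := by
    rintro _ ⟨f, hf, rfl⟩
    exact ⟨-f, hf.neg, rfl⟩

namespace HolGerm

variable {z : ℂ × ℂ}

/-- The germ of a function that is holomorphic near `z`. -/
noncomputable def mk (f : ℂ × ℂ → ℂ) (hf : AnalyticAt ℂ f z) : HolGerm z := ⟨(f : Germ (𝓝 z) ℂ), f, hf, rfl⟩

theorem exists_rep (φ : HolGerm z) : ∃ f, ∃ hf : AnalyticAt ℂ f z, mk f hf = φ := by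
  obtain ⟨_, f, hf, rfl⟩ := φ
  exact ⟨f, hf, rfl⟩

/-- The value of a germ at the base point. -/
noncomputable def value (φ : HolGerm z) : ℂ := Germ.value (φ : Germ (𝓝 z) ℂ)

theorem value_mul (φ ψ : HolGerm z) : value (φ * ψ) = value φ * value ψ := by
  obtain ⟨f, hf, rfl⟩ := exists_rep φ
  obtain ⟨g, hg, rfl⟩ := exists_rep ψ
  rfl

/-- A germ is invertible if and only if it does not vanish at the base point. -/
theorem isUnit_iff_value_ne_zero (φ : HolGerm z) : IsUnit φ ↔ value φ ≠ 0 := by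
  constructor
  · rintro ⟨u, rfl⟩ h
    have h1 : value ((u : HolGerm z) * (↑u⁻¹ : HolGerm z)) = 0 := by rw [value_mul, h, zero_mul]
    rw [Units.mul_inv] at h1
    exact one_ne_zero h1
  · obtain ⟨f, hf, rfl⟩ := exists_rep φ
    intro h
    have h0 : f z ≠ 0 := h
    refine IsUnit.of_mul_eq_one (mk f⁻¹ (hf.inv h0)) (Subtype.ext ?_)
    refine Germ.coe_eq.2 ?_
    filter_upwards [hf.continuousAt.eventually_ne h0] with w hw
    exact mul_inv_cancel₀ hw

/-- The derivative of a germ of function in the direction `v`. -/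
noncomputable def germDeriv (v : ℂ × ℂ) (φ : Germ (𝓝 z) ℂ) : Germ (𝓝 z) ℂ :=
  Quotient.map' (fun (f : ℂ × ℂ → ℂ) (w : ℂ × ℂ) => fderiv ℂ f w v)
    (fun _ _ h => (EventuallyEq.fderiv h).fun_comp (fun L => L v)) φ

/-- The derivation of `𝒪` in the direction `v`. -/
noncomputable def dir (v : ℂ × ℂ) : Derivation ℤ (HolGerm z) (HolGerm z) :=
  Derivation.mk'
    (AddMonoidHom.toIntLinearMap
      { toFun := fun φ => ⟨germDeriv v φ, by
          obtain ⟨_, f, hf, rfl⟩ := φ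
          exact ⟨fun w => fderiv ℂ f w v, (ContinuousLinearMap.apply ℂ ℂ v).analyticAt _ |>.comp hf.fderiv, rfl⟩⟩
        map_zero' := by
          refine Subtype.ext (Germ.coe_eq.2 (Eventually.of_forall fun w => ?_))
          change fderiv ℂ (fun _ => (0 : ℂ)) w v = 0
          simp
        map_add' := by
          intro φ ψ
          obtain ⟨f, hf, rfl⟩ := exists_rep φ
          obtain ⟨g, hg, rfl⟩ := exists_rep ψ
          refine Subtype.ext (Germ.coe_eq.2 ?_)
          filter_upwards [hf.eventually_analyticAt, hg.eventually_analyticAt] with w h1 h2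
          change fderiv ℂ (f + g) w v = fderiv ℂ f w v + fderiv ℂ g w v
          rw [fderiv_add h1.differentiableAt h2.differentiableAt]
          rfl })
    (by
      intro φ ψ
      obtain ⟨f, hf, rfl⟩ := exists_rep φ
      obtain ⟨g, hg, rfl⟩ := exists_rep ψ
      refine Subtype.ext (Germ.coe_eq.2 ?_)
      filter_upwards [hf.eventually_analyticAt, hg.eventually_analyticAt] with w h1 h2
      change fderiv ℂ (f * g) w v = f w * fderiv ℂ g w v + g w * fderiv ℂ f w v
      rw [fderiv_mul h1.differentiableAt h2.differentiableAt]
      rfl)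

/-- `∂/∂x`. -/
noncomputable def dx : Derivation ℤ (HolGerm z) (HolGerm z) := dir (1, 0)

/-- `∂/∂y`. -/
noncomputable def dy : Derivation ℤ (HolGerm z) (HolGerm z) := dir (0, 1)

theorem dx_dy (φ : HolGerm z) : dx (dy φ) = dy (dx φ) := by
  obtain ⟨f, hf, rfl⟩ := exists_rep φ
  refine Subtype.ext (Germ.coe_eq.2 ?_)
  filter_upwards [hf.eventually_analyticAt] with w hw
  have hs : IsSymmSndFDerivAt ℂ f w := hw.contDiffAt.isSymmSndFDerivAt_of_omega
  have hd : DifferentiableAt ℂ (fderiv ℂ f) w := hw.fderiv.differentiableAt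
  have key : ∀ u v : ℂ × ℂ,
      fderiv ℂ (fun w => fderiv ℂ f w u) w v = fderiv ℂ (fderiv ℂ f) w v u := by
    intro u v
    rw [fderiv_clm_apply hd (differentiableAt_const u)]
    simp
  change fderiv ℂ (fun w => fderiv ℂ f w (0, 1)) w (1, 0) =
    fderiv ℂ (fun w => fderiv ℂ f w (1, 0)) w (0, 1)
  rw [key, key]
  exact hs _ _

end HolGerm

open HolGerm

/-- A derivation of `𝒪` applied to the coefficients of a polynomial in `p`. -/
noncomputable def coeffDeriv {z : ℂ × ℂ} (D : Derivation ℤ (HolGerm z) (HolGerm z)) :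
    (HolGerm z)[X] →ₗ[ℤ] (HolGerm z)[X] :=
  Polynomial.lsum fun n => ((monomial n).restrictScalars ℤ).comp (D : HolGerm z →ₗ[ℤ] HolGerm z)

theorem coeffDeriv_coeff {z : ℂ × ℂ} (D : Derivation ℤ (HolGerm z) (HolGerm z))
    (G : (HolGerm z)[X]) (n : ℕ) : (coeffDeriv D G).coeff n = D (G.coeff n) := by
  induction G using Polynomial.induction_on' with
  | add G H hG hH => rw [map_add, coeff_add, coeff_add, map_add, hG, hH]
  | monomial m a =>
    by_cases h : m = n
    · subst h
      simp [coeffDeriv, Polynomial.lsum, Polynomial.sum_monomial_index]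
    · simp [coeffDeriv, Polynomial.lsum, Polynomial.sum_monomial_index, coeff_monomial, h]

/-- The operator `∂_x + p ∂_y` on `𝒪[p]`. -/
noncomputable def transport {z : ℂ × ℂ} (G : (HolGerm z)[X]) : (HolGerm z)[X] :=
  coeffDeriv dx G + X * coeffDeriv dy G

/-! ## Four-webs and the system satisfied by their abelian relations -/

/-- A non singular planar `4`-web near `z`, presented by the equation `F(x, y, y') = 0` of
degree `4` in `y'`, whose `y'`-resultant of `F` and `∂_{y'} F` does not vanish at `z`. -/
structure FourWeb (z : ℂ × ℂ) where
  /-- The polynomial `F(x, y, p) = a₀ p⁴ + a₁ p³ + a₂ p² + a₃ p + a₄`. -/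
  F : (HolGerm z)[X]
  natDegree_le : F.natDegree ≤ 4
  resultant_ne_zero : value (resultant F (derivative F) 4 3) ≠ 0

/-! ## The connection of a first order system

For a matrix `A` with `3` rows and `2` columns over `𝒪`, consider the system in `(b₃, b₄)`
* `∂_x b₄ + A₁₁ b₃ + A₁₂ b₄ = 0`
* `∂_x b₃ + ∂_y b₄ + A₂₁ b₃ + A₂₂ b₄ = 0`
* `∂_y b₃ + A₃₁ b₃ + A₃₂ b₄ = 0`
-/

/-- The module `J₁(𝒪²)` of `1`-jets `w`. The components `w 0` and `w 1`, which belong to `b₃`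
and `b₄`, are of the form `![z, p, q]`, with `p` and `q` for `∂_x` and `∂_y`. -/
abbrev Jet1 (z : ℂ × ℂ) := Fin 2 → Fin 3 → HolGerm z

/-- The module `J₂(𝒪²)` of `2`-jets `u`. The components `u 0` and `u 1`, which belong to `b₃`
and `b₄`, are of the form `![z, p, q, r, s, t]`, with `p, q, r, s, t` for `∂_x`, `∂_y`, `∂_x²`,
`∂_x ∂_y` and `∂_y²`. -/
abbrev Jet2 (z : ℂ × ℂ) := Fin 2 → Fin 6 → HolGerm z

namespace Jet2

variable {z : ℂ × ℂ}

/-- The projection `J₂(𝒪²) → J₁(𝒪²)`. -/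
noncomputable def proj : Jet2 z →ₗ[HolGerm z] Jet1 z where
  toFun u := fun k => ![u k 0, u k 1, u k 2]
  map_add' u v := by ext k i; fin_cases i <;> rfl
  map_smul' c u := by ext k i; fin_cases i <;> rfl

/-- The formal derivative with respect to `x`, that maps the `2`-jet of `b` to the `1`-jet of
`∂_x b`. -/
noncomputable def shiftX : Jet2 z →ₗ[HolGerm z] Jet1 z where
  toFun u := fun k => ![u k 1, u k 3, u k 4]
  map_add' u v := by ext k i; fin_cases i <;> rfl
  map_smul' c u := by ext k i; fin_cases i <;> rfl

/-- The formal derivative with respect to `y`, that maps the `2`-jet of `b` to the `1`-jet of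
`∂_y b`. -/
noncomputable def shiftY : Jet2 z →ₗ[HolGerm z] Jet1 z where
  toFun u := fun k => ![u k 2, u k 4, u k 5]
  map_add' u v := by ext k i; fin_cases i <;> rfl
  map_smul' c u := by ext k i; fin_cases i <;> rfl

/-- The `dx`-component of the Spencer operator `D : J₂(𝒪²) → Ω¹ ⊗ J₁(𝒪²)`. -/
noncomputable def spencerX (u : Jet2 z) : Jet1 z := fun k i => dx (proj u k i) - shiftX u k i

/-- The `dy`-component of the Spencer operator `D : J₂(𝒪²) → Ω¹ ⊗ J₁(𝒪²)`. -/
noncomputable def spencerY (u : Jet2 z) : Jet1 z := fun k i => dy (proj u k i) - shiftY u k i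

/-- The product of a `2`-jet with the `2`-jet of `g`: if `u` is the `2`-jet of `b` then this is
the `2`-jet of `g b`. -/
noncomputable def mulGerm (g : HolGerm z) (u : Jet2 z) : Jet2 z := fun k =>
  ![g * u k 0,
    g * u k 1 + dx g * u k 0,
    g * u k 2 + dy g * u k 0,
    g * u k 3 + 2 * dx g * u k 1 + dx (dx g) * u k 0,
    g * u k 4 + dx g * u k 2 + dy g * u k 1 + dx (dy g) * u k 0,
    g * u k 5 + 2 * dy g * u k 2 + dy (dy g) * u k 0]

end Jet2

namespace Sys

open Jet2

variable {z : ℂ × ℂ} (A : Matrix (Fin 3) (Fin 2) (HolGerm z))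

/-- The morphism `p₀ : J₁(𝒪²) → 𝒪³` of the system. -/
noncomputable def p0 : Jet1 z →ₗ[HolGerm z] (Fin 3 → HolGerm z) where
  toFun w := fun i =>
    (![w 1 1, w 0 1 + w 1 2, w 0 2] : Fin 3 → HolGerm z) i + (A i 0 * w 0 0 + A i 1 * w 1 0)
  map_add' w v := by ext i; fin_cases i <;> simp <;> ring
  map_smul' c w := by ext i; fin_cases i <;> simp <;> ring

/-- The first prolongation `p₁ : J₂(𝒪²) → J₁(𝒪³)` of `p₀`: the three equations of the system,
their formal derivatives with respect to `x`, and their formal derivatives with respect to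
`y`. -/
noncomputable def p1 : Jet2 z →ₗ[HolGerm z]
    (Fin 3 → HolGerm z) × (Fin 3 → HolGerm z) × (Fin 3 → HolGerm z) where
  toFun u :=
    (p0 A (proj u),
      (fun i => p0 A (shiftX u) i + (dx (A i 0) * u 0 0 + dx (A i 1) * u 1 0)),
      (fun i => p0 A (shiftY u) i + (dy (A i 0) * u 0 0 + dy (A i 1) * u 1 0)))
  map_add' u v := by
    simp only [map_add, Pi.add_apply, Prod.mk_add_mk, Prod.mk.injEq, true_and]
    constructor <;> ext i <;> simp <;> ring
  map_smul' c u := by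
    simp only [map_smul, Pi.smul_apply, Prod.smul_mk, smul_eq_mul, RingHom.id_apply,
      Prod.mk.injEq, true_and]
    constructor <;> ext i <;> simp <;> ring

/-- `R₀ = ker p₀`. -/
noncomputable def R0 : Submodule (HolGerm z) (Jet1 z) := LinearMap.ker (p0 A)

/-- The bundle `E = R₁ = ker p₁` inside `J₂(𝒪²)`. -/
noncomputable def E : Submodule (HolGerm z) (Jet2 z) := LinearMap.ker (p1 A)

variable {A}

theorem mem_E {u : Jet2 z} : u ∈ E A ↔ p0 A (proj u) = 0 ∧
    (∀ i, p0 A (shiftX u) i + (dx (A i 0) * u 0 0 + dx (A i 1) * u 1 0) = 0) ∧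
    (∀ i, p0 A (shiftY u) i + (dy (A i 0) * u 0 0 + dy (A i 1) * u 1 0) = 0) := by
  simp [E, p1, Prod.ext_iff, funext_iff]

theorem spencerX_mem {u : Jet2 z} (hu : u ∈ E A) : spencerX u ∈ R0 A := by
  obtain ⟨h0, h1, -⟩ := mem_E.1 hu
  refine LinearMap.mem_ker.2 (funext fun i => ?_)
  have e0 : dx (p0 A (proj u) i) = 0 := by rw [h0]; simp
  have e1 := h1 i
  fin_cases i <;>
  · simp [p0, proj, shiftX, spencerX] at e0 e1 ⊢
    linear_combination e0 - e1

theorem spencerY_mem {u : Jet2 z} (hu : u ∈ E A) : spencerY u ∈ R0 A := by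
  obtain ⟨h0, -, h1⟩ := mem_E.1 hu
  refine LinearMap.mem_ker.2 (funext fun i => ?_)
  have e0 : dy (p0 A (proj u) i) = 0 := by rw [h0]; simp
  have e1 := h1 i
  fin_cases i <;>
  · simp [p0, proj, shiftY, spencerY] at e0 e1 ⊢
    linear_combination e0 - e1

variable (A)

/-- The projection `π₀ : E = R₁ → R₀`. -/
noncomputable def pi0 : E A →ₗ[HolGerm z] R0 A :=
  (proj.comp (E A).subtype).codRestrict (R0 A) fun u => (mem_E.1 u.2).1

theorem pi0_bijective : Function.Bijective (pi0 A) := by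
  constructor
  · rw [injective_iff_map_eq_zero]
    intro u hu
    have hp : proj (u : Jet2 z) = 0 := congrArg Subtype.val hu
    obtain ⟨-, h1, h2⟩ := mem_E.1 u.2
    have e : ∀ k (i : Fin 3), proj (u : Jet2 z) k i = 0 := fun k i => by rw [hp]; rfl
    have a0 := e 0 0
    have a1 := e 0 1
    have a2 := e 0 2
    have b0 := e 1 0
    have b1 := e 1 1
    have b2 := e 1 2
    simp only [proj, LinearMap.coe_mk, AddHom.coe_mk, Matrix.cons_val] at a0 a1 a2 b0 b1 b2
    have x0 := h1 0
    have x1 := h1 1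
    have x2 := h1 2
    have y0 := h2 0
    have y1 := h2 1
    have y2 := h2 2
    simp only [p0, shiftX, shiftY, LinearMap.coe_mk, AddHom.coe_mk, Matrix.cons_val, a0, a1, a2,
      b0, b1, b2, mul_zero, add_zero] at x0 x1 x2 y0 y1 y2
    have s3 : (u : Jet2 z) 0 4 = 0 := x2
    have s4 : (u : Jet2 z) 1 4 = 0 := y0
    rw [s4, add_zero] at x1
    rw [s3, zero_add] at y1
    refine Subtype.ext (funext fun k => funext fun i => ?_)
    fin_cases k <;> fin_cases i <;> assumption
  · rintro ⟨w, hw⟩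
    have hw' : p0 A w = 0 := hw
    let c : (Fin 3 → HolGerm z) := fun i => A i 0 * w 0 1 + A i 1 * w 1 1 +
      dx (A i 0) * w 0 0 + dx (A i 1) * w 1 0
    let d : (Fin 3 → HolGerm z) := fun i => A i 0 * w 0 2 + A i 1 * w 1 2 +
      dy (A i 0) * w 0 0 + dy (A i 1) * w 1 0
    let u : Jet2 z := ![![w 0 0, w 0 1, w 0 2, d 0 - c 1, -c 2, -d 2],
      ![w 1 0, w 1 1, w 1 2, -c 0, -d 0, c 2 - d 1]]
    have hpr : proj u = w := by
      ext k i
      fin_cases k <;> fin_cases i <;> rfl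
    have hu : u ∈ E A := by
      refine mem_E.2 ⟨by rw [hpr, hw'], fun i => ?_, fun i => ?_⟩ <;> fin_cases i <;>
      · simp [p0, shiftX, shiftY, u, c, d]
        ring
    exact ⟨⟨u, hu⟩, Subtype.ext hpr⟩

/-- The isomorphism `π₀ : E → R₀`. -/
noncomputable def pi0Equiv : E A ≃ₗ[HolGerm z] R0 A := LinearEquiv.ofBijective _ (pi0_bijective A)

/-- The component `∇_x` of the connection `∇ = π₀⁻¹ ∘ D = ∇_x dx + ∇_y dy` on `E`. -/
noncomputable def nablaX (s : E A) : E A := (pi0Equiv A).symm ⟨spencerX s, spencerX_mem s.2⟩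

/-- The component `∇_y` of the connection `∇ = π₀⁻¹ ∘ D = ∇_x dx + ∇_y dy` on `E`. -/
noncomputable def nablaY (s : E A) : E A := (pi0Equiv A).symm ⟨spencerY s, spencerY_mem s.2⟩

theorem nablaX_add (s t : E A) : nablaX A (s + t) = nablaX A s + nablaX A t := by
  refine (pi0Equiv A).injective ?_
  rw [map_add]
  simp only [nablaX, LinearEquiv.apply_symm_apply]
  refine Subtype.ext (funext fun k => funext fun i => ?_)
  simp [spencerX]
  ring

theorem nablaY_add (s t : E A) : nablaY A (s + t) = nablaY A s + nablaY A t := by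
  refine (pi0Equiv A).injective ?_
  rw [map_add]
  simp only [nablaY, LinearEquiv.apply_symm_apply]
  refine Subtype.ext (funext fun k => funext fun i => ?_)
  simp [spencerY]
  ring

theorem nablaX_smul (f : HolGerm z) (s : E A) :
    nablaX A (f • s) = dx f • s + f • nablaX A s := by
  refine (pi0Equiv A).injective ?_
  rw [map_add, map_smul, map_smul]
  simp only [nablaX, LinearEquiv.apply_symm_apply]
  refine Subtype.ext (funext fun k => funext fun i => ?_)
  have h : ((pi0Equiv A s : R0 A) : Jet1 z) = proj (s : Jet2 z) := rfl
  simp [spencerX, h]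
  ring

theorem nablaY_smul (f : HolGerm z) (s : E A) :
    nablaY A (f • s) = dy f • s + f • nablaY A s := by
  refine (pi0Equiv A).injective ?_
  rw [map_add, map_smul, map_smul]
  simp only [nablaY, LinearEquiv.apply_symm_apply]
  refine Subtype.ext (funext fun k => funext fun i => ?_)
  have h : ((pi0Equiv A s : R0 A) : Jet1 z) = proj (s : Jet2 z) := rfl
  simp [spencerY, h]
  ring

/-- The curvature of `∇`, an `𝒪`-linear endomorphism of `E`: the curvature `∇ ∘ ∇` with values
in `Ω² ⊗ E` is this endomorphism times `dx ∧ dy`. -/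
noncomputable def curvature : E A →ₗ[HolGerm z] E A where
  toFun s := nablaX A (nablaY A s) - nablaY A (nablaX A s)
  map_add' s t := by
    simp only [nablaX_add, nablaY_add]
    abel
  map_smul' f s := by
    simp only [nablaX_add, nablaY_add, nablaX_smul, nablaY_smul, dx_dy, RingHom.id_apply,
      smul_sub]
    abel

/-- The coefficient of `dx` in the connection matrix `γ = γ_x dx + γ_y dy` in the basis `b`,
given by `∇ b_j = ∑_i γ_{ij} ⊗ b_i`. -/
noncomputable def gammaX (b : Module.Basis (Fin 3) (HolGerm z) (E A)) :
    Matrix (Fin 3) (Fin 3) (HolGerm z) := Matrix.of fun i j => b.repr (nablaX A (b j)) i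

/-- The coefficient of `dy` in the connection matrix `γ = γ_x dx + γ_y dy` in the basis `b`,
given by `∇ b_j = ∑_i γ_{ij} ⊗ b_i`. -/
noncomputable def gammaY (b : Module.Basis (Fin 3) (HolGerm z) (E A)) :
    Matrix (Fin 3) (Fin 3) (HolGerm z) := Matrix.of fun i j => b.repr (nablaY A (b j)) i

end Sys

/-! ## The system of the abelian relations of a four-web -/

namespace FourWeb

variable {z : ℂ × ℂ} (W : FourWeb z)

theorem natDegree_derivative_le : (derivative W.F).natDegree ≤ 3 :=
  (Polynomial.natDegree_derivative_le _).trans (Nat.sub_le_sub_right W.natDegree_le 1)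

theorem isUnit_resultant : IsUnit (resultant W.F (derivative W.F) 4 3) :=
  (isUnit_iff_value_ne_zero _).2 W.resultant_ne_zero

/-- Division by `F` and `∂_p F`, by the invertibility of the resultant. -/
theorem exists_combination (H : (HolGerm z)[X]) (hH : H.natDegree ≤ 6) :
    ∃ U V : (HolGerm z)[X], U.natDegree ≤ 2 ∧ V.natDegree ≤ 3 ∧
      H = U * W.F + V * derivative W.F := by
  obtain ⟨c, hc⟩ := W.isUnit_resultant.exists_left_inv
  have hm : H ∈ degreeLT (HolGerm z) (4 + 3) :=
    mem_degreeLT.2 ((natDegree_le_iff_degree_le.1 hH).trans_lt (by norm_num))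
  have key := LinearMap.congr_fun
    (sylveserMap_comp_adjSylvester W.F (derivative W.F) W.natDegree_le W.natDegree_derivative_le)
    (c • ⟨H, hm⟩)
  generalize hX : adjSylvester (m := 4) (n := 3) W.F (derivative W.F) (c • ⟨H, hm⟩) = PQ at *
  rw [LinearMap.comp_apply, hX] at key
  have key2 := congrArg Subtype.val key
  have hlt : ∀ {n : ℕ} (G : degreeLT (HolGerm z) (n + 1)), (G : (HolGerm z)[X]).natDegree ≤ n :=
    fun {n} G => natDegree_le_iff_degree_le.2 (Order.lt_succ_iff.1 (mem_degreeLT.1 G.2))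
  refine ⟨PQ.2, PQ.1, hlt _, hlt _, ?_⟩
  simp only [sylvesterMap_apply_coe, LinearMap.smul_apply, LinearMap.id_apply, smul_smul] at key2
  rw [mul_comm _ c, hc, one_smul] at key2
  have key3 : W.F * (PQ.2 : (HolGerm z)[X]) + derivative W.F * (PQ.1 : (HolGerm z)[X]) = H := key2
  rw [← key3]
  ring

theorem combination_unique {U V : (HolGerm z)[X]} (hU : U.natDegree ≤ 2) (hV : V.natDegree ≤ 3)
    (h : U * W.F + V * derivative W.F = 0) : U = 0 ∧ V = 0 := by
  obtain ⟨c, hc⟩ := W.isUnit_resultant.exists_left_inv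
  have hmU : U ∈ degreeLT (HolGerm z) 3 :=
    mem_degreeLT.2 ((natDegree_le_iff_degree_le.1 hU).trans_lt (by norm_num))
  have hmV : V ∈ degreeLT (HolGerm z) 4 :=
    mem_degreeLT.2 ((natDegree_le_iff_degree_le.1 hV).trans_lt (by norm_num))
  have key := LinearMap.congr_fun
    (adjSylvester_comp_sylveserMap W.F (derivative W.F) W.natDegree_le W.natDegree_derivative_le)
    (⟨V, hmV⟩, ⟨U, hmU⟩)
  have h0 : sylvesterMap W.F (derivative W.F) W.natDegree_le W.natDegree_derivative_le
      (⟨V, hmV⟩, ⟨U, hmU⟩) = 0 := by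
    refine Subtype.ext ?_
    simp only [sylvesterMap_apply_coe, ZeroMemClass.coe_zero]
    rw [← h]
    ring
  rw [LinearMap.comp_apply, h0, map_zero] at key
  have key2 := congrArg (fun x => c • x) key
  simp only [smul_zero, LinearMap.smul_apply, LinearMap.id_apply, smul_smul, hc, one_smul] at key2
  exact ⟨(congrArg (fun x => (x.2 : (HolGerm z)[X])) key2).symm,
    (congrArg (fun x => (x.1 : (HolGerm z)[X])) key2).symm⟩

/-- The relation which says that the form `ω = r (dy - p dx) / ∂_p F` on the surface `F = 0` is
regular, and that `dω = t (dx ∧ dy) / ∂_p F`. -/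
def IsDifferential (r t : (HolGerm z)[X]) : Prop :=
  t.natDegree ≤ 2 ∧ ∃ rp : (HolGerm z)[X], rp.natDegree ≤ 3 ∧
    r * transport W.F + rp * derivative W.F = (transport r + derivative rp - t) * W.F

theorem natDegree_transport_le {G : (HolGerm z)[X]} {n : ℕ} (h : G.natDegree ≤ n) :
    (transport G).natDegree ≤ n + 1 := by
  have hc : ∀ D : Derivation ℤ (HolGerm z) (HolGerm z), (coeffDeriv D G).natDegree ≤ n := by
    intro D
    refine natDegree_le_iff_coeff_eq_zero.2 fun N hN => ?_
    rw [coeffDeriv_coeff, coeff_eq_zero_of_natDegree_lt (h.trans_lt hN), map_zero]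
  refine (natDegree_add_le _ _).trans (max_le ((hc _).trans n.le_succ) ?_)
  refine natDegree_mul_le.trans ?_
  have := hc dy
  have := natDegree_X_le (R := HolGerm z)
  lia

theorem existsUnique_isDifferential {r : (HolGerm z)[X]} (hr : r.natDegree ≤ 1) :
    ∃! t, W.IsDifferential r t := by
  have hX := natDegree_transport_le hr
  have hd : ∀ {G : (HolGerm z)[X]}, G.natDegree ≤ 3 → (derivative G).natDegree ≤ 2 :=
    fun h => (Polynomial.natDegree_derivative_le _).trans (Nat.sub_le_sub_right h 1)
  obtain ⟨U, V, hU, hV, h⟩ := W.exists_combination (r * transport W.F)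
    (natDegree_mul_le.trans (add_le_add hr (natDegree_transport_le W.natDegree_le)))
  refine ⟨transport r - derivative V - U, ⟨?_, -V, by rwa [natDegree_neg], ?_⟩, ?_⟩
  · exact (natDegree_sub_le _ _).trans
      (max_le ((natDegree_sub_le _ _).trans (max_le hX (hd hV))) hU)
  · rw [h, derivative_neg]
    ring
  · rintro t ⟨ht, rp, hrp, e⟩
    have hs : (transport r + derivative rp - t - U).natDegree ≤ 2 :=
      (natDegree_sub_le _ _).trans (max_le ((natDegree_sub_le _ _).trans
        (max_le ((natDegree_add_le _ _).trans (max_le hX (hd hrp))) ht)) hU)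
    have hv : (-rp - V).natDegree ≤ 3 :=
      (natDegree_sub_le _ _).trans (max_le (by rwa [natDegree_neg]) hV)
    obtain ⟨h1, h2⟩ := W.combination_unique hs hv (by linear_combination h - e)
    have h3 : rp = -V := by linear_combination -h2
    rw [h3, derivative_neg] at h1
    linear_combination -h1

theorem natDegree_numerator_le (b : Fin 2 → HolGerm z) : (C (b 0) * X + C (b 1)).natDegree ≤ 1 :=
  natDegree_linear_le

/-- The operator `(b₃, b₄) ↦ t = t₂ p² + t₃ p + t₄` given by the exterior differential of
`ω = (b₃ p + b₄) (dy - p dx) / ∂_p F`. -/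
noncomputable def rho (b : Fin 2 → HolGerm z) : (HolGerm z)[X] :=
  (W.existsUnique_isDifferential (natDegree_numerator_le b)).choose

theorem rho_eq_iff (b : Fin 2 → HolGerm z) (t : (HolGerm z)[X]) :
    W.rho b = t ↔ W.IsDifferential (C (b 0) * X + C (b 1)) t := by
  have h := (W.existsUnique_isDifferential (natDegree_numerator_le b)).choose_spec
  exact ⟨fun e => e ▸ h.1, fun e => (h.2 t e).symm⟩

/-- The matrix `(A_{ij})` of the system: the zeroth order coefficients of the operator `rho`. The
rows belong to the coefficients of `1, p, p²` in `t`, the columns to `b₃, b₄`. -/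
noncomputable def A : Matrix (Fin 3) (Fin 2) (HolGerm z) :=
  Matrix.of fun i j => (W.rho (Pi.single j 1)).coeff i

/-- The form `ω` of numerator `b₃ p + b₄` is closed if and only if `(b₃, b₄)` is a solution of the
system of matrix `A`: more precisely, the equations of this system are the coefficients of
`t`. -/
theorem rho_coeff (b : Fin 2 → HolGerm z) (i : Fin 3) :
    (W.rho b).coeff i =
      (![dx (b 1), dx (b 0) + dy (b 1), dy (b 0)] : Fin 3 → HolGerm z) i +
        (W.A i 0 * b 0 + W.A i 1 * b 1) := by
  obtain ⟨h0, r0, hr0, e0⟩ := (W.rho_eq_iff (Pi.single 0 1) _).1 rfl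
  obtain ⟨h1, r1, hr1, e1⟩ := (W.rho_eq_iff (Pi.single 1 1) _).1 rfl
  have hcd : ∀ (D : Derivation ℤ (HolGerm z) (HolGerm z)) (c d : HolGerm z),
      coeffDeriv D (C c * X + C d) = C (D c) * X + C (D d) := by
    intro D c d
    ext n
    rw [coeffDeriv_coeff]
    rcases n with _ | _ | n <;> simp [coeff_X, coeff_C]
  have htr : ∀ c d : HolGerm z, transport (C c * X + C d) =
      C (dy c) * X ^ 2 + C (dx c + dy d) * X + C (dx d) := by
    intro c d
    rw [transport, hcd, hcd, map_add]
    ring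
  have key : W.rho b = C (dy (b 0)) * X ^ 2 + C (dx (b 0) + dy (b 1)) * X + C (dx (b 1)) +
      C (b 0) * W.rho (Pi.single 0 1) + C (b 1) * W.rho (Pi.single 1 1) := by
    refine (W.rho_eq_iff b _).2 ⟨?_, C (b 0) * r0 + C (b 1) * r1, ?_, ?_⟩
    · refine (natDegree_add_le _ _).trans (max_le ((natDegree_add_le _ _).trans
        (max_le natDegree_quadratic_le ?_)) ?_)
      · exact (natDegree_C_mul_le _ _).trans h0
      · exact (natDegree_C_mul_le _ _).trans h1
    · exact (natDegree_add_le _ _).trans (max_le ((natDegree_C_mul_le _ _).trans hr0)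
        ((natDegree_C_mul_le _ _).trans hr1))
    · rw [htr] at e0 e1 ⊢
      simp only [derivative_add, derivative_C_mul]
      simp at e0 e1
      simp only [map_add]
      linear_combination C (b 0) * e0 + C (b 1) * e1
  rw [key]
  fin_cases i <;> simp [A, coeff_X, coeff_C, coeff_X_pow] <;> ring

/-- The bundle `E` of rank `3` that carries the connection associated with the web. -/
noncomputable abbrev bundle : Submodule (HolGerm z) (Jet2 z) := Sys.E W.A

/-- The coefficient of `dx ∧ dy` in the curvature of the connection associated with the web. -/
noncomputable abbrev curvature : W.bundle →ₗ[HolGerm z] W.bundle := Sys.curvature W.A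

/-- The web presented by `g F = 0` with `g` invertible. -/
noncomputable def rescale (g : (HolGerm z)ˣ) : FourWeb z where
  F := C (g : HolGerm z) * W.F
  natDegree_le := (natDegree_C_mul_le _ _).trans W.natDegree_le
  resultant_ne_zero := by
    rw [derivative_C_mul, resultant_C_mul_left, resultant_C_mul_right]
    refine (isUnit_iff_value_ne_zero _).1 ?_
    exact (g.isUnit.pow _).mul ((g.isUnit.pow _).mul W.isUnit_resultant)

/-- `P` is a linearization polynomial of the web: its degree in `p` is at most `3`, and
`∂_x q + q ∂_y q = P(x, y, q)` for all slopes `q` of the web, that is, for all roots `q ∈ 𝒪`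
of `F`. So the leaves are solutions of `y'' = P(x, y, y')`. -/
def IsLinearizationPolynomial (P : (HolGerm z)[X]) : Prop :=
  P.natDegree ≤ 3 ∧ ∀ q : HolGerm z, W.F.eval q = 0 → dx q + q * dy q = P.eval q

end FourWeb

/-! ## The linearizability expressions -/

section

variable {z : ℂ × ℂ} (P : (HolGerm z)[X])

/-- The expression `L₁` of `P = l₁ p³ + l₂ p² + l₃ p + l₄`. -/
noncomputable def linearizabilityL1 : HolGerm z :=
  let l₁ := P.coeff 3
  let l₂ := P.coeff 2
  let l₃ := P.coeff 1
  let l₄ := P.coeff 0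
  dx (dx l₂ - 2 * dy l₃) - l₃ * (dx l₂ - 2 * dy l₃) + 3 * dy (dy l₄)
    - 3 * dy (l₂ * l₄) + 3 * dx (l₄ * l₁) + 3 * l₄ * dx l₁

/-- The expression `L₂` of `P = l₁ p³ + l₂ p² + l₃ p + l₄`. -/
noncomputable def linearizabilityL2 : HolGerm z :=
  let l₁ := P.coeff 3
  let l₂ := P.coeff 2
  let l₃ := P.coeff 1
  let l₄ := P.coeff 0
  3 * dx (dx l₁) - dy (2 * dx l₂ - dy l₃) - l₂ * (2 * dx l₂ - dy l₃)
    + 3 * dx (l₃ * l₁) - 3 * dy (l₄ * l₁) - 3 * l₁ * dy l₄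

end

/-! The system has a one-dimensional symbol kernel: on `E` a 2-jet is determined by `b₃`, `b₄` and
`∂_x b₃`. By the symmetry of mixed derivatives the curvature of any section has zero 0-jet, so the
curvature takes values in the line `g₀ ⊂ E` of elements with zero 0-jet, spanned by `b₁`. Two rows
of the matrix therefore vanish, and the remaining row is one scalar identity, `Sys.curvature_b3_x`,
in the entries `A_{ij}` and their derivatives up to order two. Replacing `b₂` by `b₂ + c b₁` adds `c
k₁` to the second entry of that row, and likewise for `b₃`; `Sys.adaptedBasis` is the choice that
turns these entries into `∂k₁ + L`. The trace of `γ ∧ γ` is zero, so `k₁` is also the coefficient of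
`d(tr γ)`.

The expressions `L₁, L₂` enter through a cubic `Sys.linPoly` built from the `A_{ij}`. It equals
`ρ(p) - p ρ(1)`, where `ρ(r)` is the `t` attached to the numerator `r`. Eliminating `∂_x F + p ∂_y
F` between the relations for `r = p` and `r = 1`, and using that `F` and `∂_p F` are coprime,
identifies it with the `r_p` of `r = 1`; the relation for `r = 1`, evaluated at a slope, then says
that the cubic is a linearization polynomial (`FourWeb.transport_add_mul_derivative`). Uniqueness is
interpolation at the four slopes, which exist by the implicit function theorem.

For `gF = 0`, the numerator `g r` gives the same form `ω`. The two systems are thus related by the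
gauge change `b ↦ g b`, and multiplication by the 2-jet of `g` commutes with the Spencer operator,
hence with the connection and its curvature. -/

namespace HolGerm

/-! ### The slopes as holomorphic germs, and interpolation at the slopes. -/

variable {z : ℂ × ℂ}

/-- Evaluation of germs at the base point, as a ring homomorphism. -/
noncomputable def valueHom (z : ℂ × ℂ) : HolGerm z →+* ℂ :=
  { toFun := value, map_one' := rfl, map_zero' := rfl, map_mul' := value_mul
    map_add' := fun φ ψ => by
      obtain ⟨f, hf, rfl⟩ := exists_rep φ
      obtain ⟨g, hg, rfl⟩ := exists_rep ψ
      rfl }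

theorem valueHom_apply (φ : HolGerm z) : valueHom z φ = value φ := rfl

/-- Implicit function theorem: a simple root at the base point extends to a root in `𝒪`. -/
theorem exists_eval_eq_zero (F : (HolGerm z)[X]) (c : ℂ) (h0 : (F.map (valueHom z)).eval c = 0)
    (h1 : (derivative (F.map (valueHom z))).eval c ≠ 0) :
    ∃ q : HolGerm z, value q = c ∧ F.eval q = 0 := by
  choose f hf hfF using fun n => exists_rep (F.coeff n)
  set G : (ℂ × ℂ) × ℂ → ℂ := fun v => ∑ n ∈ Finset.range (F.natDegree + 1), f n v.1 * v.2 ^ n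
    with hG
  have hGan : AnalyticAt ℂ G (z, c) := by
    refine Finset.analyticAt_fun_sum _ fun n _ => AnalyticAt.mul ?_ (analyticAt_snd.pow n)
    exact AnalyticAt.fun_comp (g := f n) (hf n) analyticAt_fst
  have hGz : ∀ p : ℂ, G (z, p) = (F.map (valueHom z)).eval p := by
    intro p
    rw [eval_map, eval₂_eq_sum_range]
    refine Finset.sum_congr rfl fun n _ => ?_
    rw [← hfF n]
    rfl
  -- The exponent `⊤` is the analytic one, so the implicit function is analytic as well.
  have hcd : ContDiffAt ℂ ⊤ G (z, c) := hGan.contDiffAt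
  have hder : (fderiv ℂ G (z, c) ∘L .inr ℂ (ℂ × ℂ) ℂ) =
      ContinuousLinearMap.toSpanSingleton ℂ ((derivative (F.map (valueHom z))).eval c) := by
    have hA : HasFDerivAt (fun p : ℂ => G (z, p)) (fderiv ℂ G (z, c) ∘L .inr ℂ (ℂ × ℂ) ℂ) c :=
      HasFDerivAt.comp c hGan.differentiableAt.hasFDerivAt (hasFDerivAt_prodMk_right z c)
    have hB : HasDerivAt (fun p : ℂ => G (z, p)) ((derivative (F.map (valueHom z))).eval c) c := by
      simp only [hGz]
      exact Polynomial.hasDerivAt _ c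
    exact hA.unique hB.hasFDerivAt
  have hinv : (fderiv ℂ G (z, c) ∘L .inr ℂ (ℂ × ℂ) ℂ).IsInvertible := by
    rw [hder]
    refine ⟨ContinuousLinearEquiv.unitsEquivAut ℂ (Units.mk0 _ h1), ?_⟩
    ext
    simp
  set q := hcd.implicitFunction (by simp) hinv
  have hq : AnalyticAt ℂ q z := (hcd.contDiffAt_implicitFunction (by simp) hinv).analyticAt
  refine ⟨mk q hq, hcd.implicitFunction_apply_self (by simp) hinv, ?_⟩
  have hev : F.eval (mk q hq) = mk (fun w => G (w, q w)) (AnalyticAt.fun_comp (g := G)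
      (by rw [show q z = c from hcd.implicitFunction_apply_self (by simp) hinv]; exact hGan)
      (analyticAt_id.prod hq)) := by
    refine Subtype.ext ?_
    rw [eval_eq_sum_range]
    simp only [← hfF, AddSubmonoidClass.coe_finsetSum]
    refine Eq.trans ?_ (map_sum (Germ.coeRingHom (R := ℂ) (𝓝 z))
      (fun n w => f n w * q w ^ n) (Finset.range (F.natDegree + 1))).symm |>.trans ?_
    · rfl
    · refine Germ.coe_eq.2 (Eventually.of_forall fun w => ?_)
      simp [hG]
  rw [hev]
  refine Subtype.ext (Germ.coe_eq.2 ?_)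
  filter_upwards [hcd.eventually_apply_implicitFunction (by simp) hinv] with w hw
  exact hw.trans ((hGz c).trans h0)

end HolGerm

namespace FourWeb

variable {z : ℂ × ℂ} (W : FourWeb z)

/-- Evaluate a Bézout relation `1 = U F + V ∂_p F` at `q`. -/
theorem isUnit_eval_derivative {q : HolGerm z} (hq : W.F.eval q = 0) :
    IsUnit ((derivative W.F).eval q) := by
  obtain ⟨U, V, -, -, h⟩ := W.exists_combination 1 (by simp)
  have h' := congrArg (eval q) h
  simp only [eval_one, eval_add, eval_mul, hq, mul_zero, zero_add] at h'
  exact IsUnit.of_mul_eq_one_right _ h'.symm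

theorem resultant_map_ne_zero : resultant (W.F.map (valueHom z))
    (derivative (W.F.map (valueHom z))) 4 3 ≠ 0 := by
  rw [derivative_map, resultant_map_map]
  exact W.resultant_ne_zero

theorem natDegree_map : (W.F.map (valueHom z)).natDegree = 4 := by
  by_contra h
  have h4 : (W.F.map (valueHom z)).natDegree ≤ 4 := natDegree_map_le.trans W.natDegree_le
  -- The resultant is taken in the formal degrees 4 and 3, so it vanishes as soon as both degrees
  -- drop.
  refine W.resultant_map_ne_zero (resultant_eq_zero_of_lt_lt _ _ _ _ (lt_of_le_of_ne h4 h) ?_)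
  have := Polynomial.natDegree_derivative_le (W.F.map (valueHom z))
  lia

theorem isUnit_coeff_four : IsUnit (W.F.coeff 4) := by
  rw [isUnit_iff_value_ne_zero, ← valueHom_apply, ← coeff_map]
  have h := W.natDegree_map
  rw [← h]
  refine leadingCoeff_ne_zero.2 fun h0 => ?_
  simp [h0] at h

theorem separable_map : (W.F.map (valueHom z)).Separable := by
  have h := W.natDegree_map
  have hd : (derivative (W.F.map (valueHom z))).natDegree = 3 := by
    rw [Polynomial.natDegree_derivative, h]
  by_contra hs
  refine W.resultant_map_ne_zero ?_
  have hne : W.F.map (valueHom z) ≠ 0 := fun h0 => by simp [h0] at h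
  -- By default this resultant is in the actual degrees, which `h` and `hd` identify with 4 and 3.
  have hz := (resultant_eq_zero_iff (f := W.F.map (valueHom z))
    (g := derivative (W.F.map (valueHom z)))).2 ⟨Or.inl hne, hs⟩
  rwa [h, hd] at hz

/-- The four slopes of the web. -/
theorem exists_slopes : ∃ q : Fin 4 → HolGerm z, (∀ i, W.F.eval (q i) = 0) ∧
    Function.Injective fun i => value (q i) := by
  set f := W.F.map (valueHom z) with hf
  have hcard : f.roots.toFinset.card = 4 := by
    rw [Multiset.toFinset_card_of_nodup (nodup_roots W.separable_map),
      ← W.natDegree_map]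
    exact splits_iff_card_roots.1 (IsAlgClosed.splits f)
  let e := (Finset.equivFinOfCardEq hcard).symm
  have hroot : ∀ i, f.eval (e i : ℂ) = 0 := fun i =>
    (mem_roots'.1 (Multiset.mem_toFinset.1 (e i).2)).2
  have hq : ∀ i, ∃ q : HolGerm z, value q = e i ∧ W.F.eval q = 0 := fun i =>
    exists_eval_eq_zero _ _ (hroot i)
      (W.separable_map.eval₂_derivative_ne_zero (RingHom.id ℂ) (hroot i))
  choose q hv hq0 using hq
  refine ⟨q, hq0, fun i j hij => ?_⟩
  simp only [hv] at hij
  exact e.injective (Subtype.ext hij)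

/-- The slopes have distinct values at `z`, so their Vandermonde determinant is a unit of `𝒪`; this
gives the uniqueness of the linearization polynomial. -/
theorem eq_of_eval_eq {P Q : (HolGerm z)[X]} (hP : P.natDegree ≤ 3) (hQ : Q.natDegree ≤ 3)
    (h : ∀ q, W.F.eval q = 0 → P.eval q = Q.eval q) : P = Q := by
  obtain ⟨q, hq, hinj⟩ := W.exists_slopes
  have hu : IsUnit (Matrix.vandermonde q).det := by
    rw [isUnit_iff_value_ne_zero, ← valueHom_apply, RingHom.map_det, RingHom.mapMatrix_apply]
    have : (Matrix.vandermonde q).map (valueHom z) = Matrix.vandermonde fun i => value (q i) := by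
      ext i j
      simp [Matrix.vandermonde_apply, ← valueHom_apply, map_pow]
    rw [this]
    exact Matrix.det_vandermonde_ne_zero_iff.2 hinj
  have key : (Matrix.vandermonde q).mulVec (fun i : Fin 4 => (P - Q).coeff i) = 0 := by
    funext i
    have hd : (P - Q).natDegree < 4 :=
      Nat.lt_succ_of_le ((natDegree_sub_le _ _).trans (max_le hP hQ))
    have h0 : (P - Q).eval (q i) = 0 := by rw [eval_sub, h _ (hq i), sub_self]
    rw [eval_eq_sum_range' hd, Finset.sum_range] at h0
    rw [Pi.zero_apply, ← h0]
    simp only [Matrix.mulVec, dotProduct, Matrix.vandermonde_apply]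
    exact Finset.sum_congr rfl fun _ _ => mul_comm _ _
  have hc := Matrix.mulVec_injective_of_isUnit ((Matrix.isUnit_iff_isUnit_det _).2 hu)
    (key.trans (Matrix.mulVec_zero _).symm)
  ext1 n
  rcases lt_or_ge n 4 with hn | hn
  · exact sub_eq_zero.1 ((coeff_sub P Q n).symm.trans (congrFun hc ⟨n, hn⟩))
  · rw [coeff_eq_zero_of_natDegree_lt (hP.trans_lt hn), coeff_eq_zero_of_natDegree_lt (hQ.trans_lt hn)]

end FourWeb

/-! ### Connection and curvature of a first order system in coordinates. -/

namespace Sys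

open Jet2

variable {z : ℂ × ℂ} (A : Matrix (Fin 3) (Fin 2) (HolGerm z))

theorem proj_nablaX (s : E A) : proj (nablaX A s : Jet2 z) = spencerX (s : Jet2 z) :=
  congrArg Subtype.val ((pi0Equiv A).apply_symm_apply ⟨spencerX s, spencerX_mem s.2⟩)

theorem proj_nablaY (s : E A) : proj (nablaY A s : Jet2 z) = spencerY (s : Jet2 z) :=
  congrArg Subtype.val ((pi0Equiv A).apply_symm_apply ⟨spencerY s, spencerY_mem s.2⟩)

section coordinates

variable {A} (s : E A)

/-! The values `s 0 0`, `s 1 0`, `s 0 1` are coordinates on `E`, that determine the other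
components. -/

theorem coord_b4_x : (s : Jet2 z) 1 1 = -(A 0 0 * (s : Jet2 z) 0 0 + A 0 1 * (s : Jet2 z) 1 0) := by
  have h := congrFun (mem_E.1 s.2).1 0
  simp [p0, proj] at h
  linear_combination h

theorem coord_b4_y : (s : Jet2 z) 1 2 =
    -((s : Jet2 z) 0 1 + A 1 0 * (s : Jet2 z) 0 0 + A 1 1 * (s : Jet2 z) 1 0) := by
  have h := congrFun (mem_E.1 s.2).1 1
  simp [p0, proj] at h
  linear_combination h

theorem coord_b3_y : (s : Jet2 z) 0 2 = -(A 2 0 * (s : Jet2 z) 0 0 + A 2 1 * (s : Jet2 z) 1 0) := by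
  have h := congrFun (mem_E.1 s.2).1 2
  simp [p0, proj] at h
  linear_combination h

theorem coord_b3_xy : (s : Jet2 z) 0 4 =
    -(A 2 0 * (s : Jet2 z) 0 1 - A 2 1 * (A 0 0 * (s : Jet2 z) 0 0 + A 0 1 * (s : Jet2 z) 1 0)
      + dx (A 2 0) * (s : Jet2 z) 0 0 + dx (A 2 1) * (s : Jet2 z) 1 0) := by
  have h := (mem_E.1 s.2).2.1 2
  simp [p0, shiftX] at h
  rw [coord_b4_x] at h
  linear_combination h

/-- Eliminate `∂_x ∂_y b₄` between the `x`-derivative of the second equation and the `y`-derivative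
of the first. -/
theorem coord_b3_xx : (s : Jet2 z) 0 3 =
    -A 0 0 * (A 2 0 * (s : Jet2 z) 0 0 + A 2 1 * (s : Jet2 z) 1 0)
      - A 0 1 * ((s : Jet2 z) 0 1 + A 1 0 * (s : Jet2 z) 0 0 + A 1 1 * (s : Jet2 z) 1 0)
      + dy (A 0 0) * (s : Jet2 z) 0 0 + dy (A 0 1) * (s : Jet2 z) 1 0
      - A 1 0 * (s : Jet2 z) 0 1
      + A 1 1 * (A 0 0 * (s : Jet2 z) 0 0 + A 0 1 * (s : Jet2 z) 1 0)
      - dx (A 1 0) * (s : Jet2 z) 0 0 - dx (A 1 1) * (s : Jet2 z) 1 0 := by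
  have h := (mem_E.1 s.2).2.1 1
  have h' := (mem_E.1 s.2).2.2 0
  simp [p0, shiftX, shiftY] at h h'
  rw [coord_b4_x] at h
  rw [coord_b4_y, coord_b3_y] at h'
  linear_combination h - h'

theorem nablaX_b3 : (nablaX A s : Jet2 z) 0 0 = dx ((s : Jet2 z) 0 0) - (s : Jet2 z) 0 1 :=
  congrFun (congrFun (proj_nablaX A s) 0) 0

theorem nablaX_b4 : (nablaX A s : Jet2 z) 1 0 =
    dx ((s : Jet2 z) 1 0) + (A 0 0 * (s : Jet2 z) 0 0 + A 0 1 * (s : Jet2 z) 1 0) := by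
  have h : (nablaX A s : Jet2 z) 1 0 = dx ((s : Jet2 z) 1 0) - (s : Jet2 z) 1 1 :=
    congrFun (congrFun (proj_nablaX A s) 1) 0
  rw [h, coord_b4_x]
  ring

theorem nablaX_b3_x : (nablaX A s : Jet2 z) 0 1 = dx ((s : Jet2 z) 0 1) - (s : Jet2 z) 0 3 :=
  congrFun (congrFun (proj_nablaX A s) 0) 1

theorem nablaY_b3 : (nablaY A s : Jet2 z) 0 0 =
    dy ((s : Jet2 z) 0 0) + (A 2 0 * (s : Jet2 z) 0 0 + A 2 1 * (s : Jet2 z) 1 0) := by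
  have h : (nablaY A s : Jet2 z) 0 0 = dy ((s : Jet2 z) 0 0) - (s : Jet2 z) 0 2 :=
    congrFun (congrFun (proj_nablaY A s) 0) 0
  rw [h, coord_b3_y]
  ring

theorem nablaY_b4 : (nablaY A s : Jet2 z) 1 0 = dy ((s : Jet2 z) 1 0) +
    ((s : Jet2 z) 0 1 + A 1 0 * (s : Jet2 z) 0 0 + A 1 1 * (s : Jet2 z) 1 0) := by
  have h : (nablaY A s : Jet2 z) 1 0 = dy ((s : Jet2 z) 1 0) - (s : Jet2 z) 1 2 :=
    congrFun (congrFun (proj_nablaY A s) 1) 0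
  rw [h, coord_b4_y]
  ring

theorem nablaY_b3_x : (nablaY A s : Jet2 z) 0 1 = dy ((s : Jet2 z) 0 1) - (s : Jet2 z) 0 4 :=
  congrFun (congrFun (proj_nablaY A s) 0) 1

/-- In jet components `(z, p, q, r, s, t)` the 0-jet of `∇_x ∇_y` is `∂_x ∂_y z - ∂_x q - ∂_y p +
s`, which is symmetric in `x` and `y`. The same holds for `b₄`. -/
theorem curvature_b3 : (curvature A s : Jet2 z) 0 0 = 0 := by
  have h : (curvature A s : Jet2 z) 0 0 =
    (nablaX A (nablaY A s) : Jet2 z) 0 0 - (nablaY A (nablaX A s) : Jet2 z) 0 0 := rfl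
  rw [h, nablaX_b3, nablaY_b3, nablaY_b3, nablaX_b3, nablaX_b4, nablaY_b3_x, coord_b3_xy]
  simp [dx_dy]
  ring

theorem curvature_b4 : (curvature A s : Jet2 z) 1 0 = 0 := by
  have h : (curvature A s : Jet2 z) 1 0 =
    (nablaX A (nablaY A s) : Jet2 z) 1 0 - (nablaY A (nablaX A s) : Jet2 z) 1 0 := rfl
  rw [h, nablaX_b4, nablaY_b4, nablaY_b4, nablaY_b3, nablaX_b3, nablaX_b4, nablaX_b3_x,
    coord_b3_xx]
  simp [dx_dy]
  ring

end coordinates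

/-- The trace of the curvature of the connection. -/
noncomputable def traceCurvature : HolGerm z :=
  dx (2 * A 2 0 + A 1 1) - dy (2 * A 0 1 + A 1 0)

/-- The polynomial `l₁ p³ + l₂ p² + l₃ p + l₄` read off from the coefficients of the system. -/
noncomputable def linPoly : (HolGerm z)[X] :=
  Cubic.toPoly ⟨-A 2 1, A 2 0 - A 1 1, A 1 0 - A 0 1, A 0 0⟩

/-- Up to sign this is the first row of the curvature matrix. The expression multiplied by
`traceCurvature` is minus the first adapted coordinate, and the factor 3 clears denominators. -/
theorem curvature_b3_x (s : E A) : 3 * (curvature A s : Jet2 z) 0 1 =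
    traceCurvature A * (3 * (s : Jet2 z) 0 1 + (A 0 1 + 2 * A 1 0) * (s : Jet2 z) 0 0
      - (A 2 0 - A 1 1) * (s : Jet2 z) 1 0)
    + (dx (traceCurvature A) + linearizabilityL1 (linPoly A)) * (s : Jet2 z) 0 0
    - (dy (traceCurvature A) + linearizabilityL2 (linPoly A)) * (s : Jet2 z) 1 0 := by
  have h : (curvature A s : Jet2 z) 0 1 =
    (nablaX A (nablaY A s) : Jet2 z) 0 1 - (nablaY A (nablaX A s) : Jet2 z) 0 1 := rfl
  rw [h, nablaX_b3_x, coord_b3_xx, nablaY_b3_x (nablaX A s), coord_b3_xy (nablaX A s),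
    nablaY_b3_x, coord_b3_xy, nablaX_b3_x, coord_b3_xx, nablaX_b3, nablaX_b4, nablaY_b3, nablaY_b4]
  -- `two_mul` replaces the factor 2 under a derivation by a sum, so that no derivative of a numeral
  -- appears.
  simp only [traceCurvature, linearizabilityL1, linearizabilityL2, linPoly, Cubic.coeff_eq_a,
    Cubic.coeff_eq_b, Cubic.coeff_eq_c, Cubic.coeff_eq_d, two_mul,
    map_add, map_sub, map_neg, Derivation.leibniz, smul_eq_mul, dx_dy]
  ring

/-! ### The adapted basis and the curvature matrix. -/

theorem exists_three_mul_eq_one : ∃ t : HolGerm z, 3 * t = 1 := by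
  refine ⟨mk (fun _ => 3⁻¹) analyticAt_const, Subtype.ext (Germ.coe_eq.2 ?_)⟩
  exact Eventually.of_forall fun _ => mul_inv_cancel₀ (three_ne_zero (α := ℂ))

/-- Derivations are only assumed `ℤ`-linear, so the constancy of `1/3` is deduced from `D 1 = 0`. -/
theorem derivation_eq_zero_of_three_mul {t : HolGerm z} (ht : 3 * t = 1)
    (D : Derivation ℤ (HolGerm z) (HolGerm z)) : D t = 0 := by
  have h : D (t + t + t) = 0 := by
    rw [show t + t + t = 1 by rw [← ht]; ring, Derivation.map_one_eq_zero]
  simp only [map_add] at h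
  linear_combination t * h - D t * ht

/-- The coordinates on `R₀ ≃ E` with respect to the basis adapted to `g₀ ⊂ E`. -/
noncomputable def adaptedCoordR0 {t : HolGerm z} (ht : 3 * t = 1) :
    R0 A ≃ₗ[HolGerm z] (Fin 3 → HolGerm z) where
  -- The coefficients of `b₃` and `b₄` are dictated by `curvature_b3_x`: they absorb all
  -- undifferentiated multiples of the trace.
  toFun w := ![-(3 * (w : Jet1 z) 0 1 + (A 0 1 + 2 * A 1 0) * (w : Jet1 z) 0 0
    - (A 2 0 - A 1 1) * (w : Jet1 z) 1 0), -(w : Jet1 z) 0 0, (w : Jet1 z) 1 0]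
  map_add' v w := by
    ext i
    fin_cases i <;> simp <;> ring
  map_smul' c w := by
    ext i
    fin_cases i <;> simp
    ring
  invFun α :=
    -- The first coordinate is solved for `∂_x b₃`; the other three derivatives come from the
    -- equations of the system.
    ⟨![![-α 1, t * (-α 0 + (A 0 1 + 2 * A 1 0) * α 1 + (A 2 0 - A 1 1) * α 2),
        A 2 0 * α 1 - A 2 1 * α 2],
      ![α 2, A 0 0 * α 1 - A 0 1 * α 2,
        -(t * (-α 0 + (A 0 1 + 2 * A 1 0) * α 1 + (A 2 0 - A 1 1) * α 2))
          + A 1 0 * α 1 - A 1 1 * α 2]], by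
      refine LinearMap.mem_ker.2 (funext fun i => ?_)
      fin_cases i <;> simp [p0] <;> ring⟩
  left_inv w := by
    have hw : p0 A w = 0 := w.2
    have h0 := congrFun hw 0
    have h1 := congrFun hw 1
    have h2 := congrFun hw 2
    simp [p0] at h0 h1 h2
    refine Subtype.ext (funext fun k => funext fun i => ?_)
    fin_cases k <;> fin_cases i <;> simp
    · linear_combination (w : Jet1 z) 0 1 * ht
    · linear_combination -h2
    · linear_combination -h0
    · linear_combination -(w : Jet1 z) 0 1 * ht - h1
  right_inv α := by
    funext i
    fin_cases i <;> simp
    linear_combination (α 0 - (A 0 1 + 2 * A 1 0) * α 1 - (A 2 0 - A 1 1) * α 2) * ht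

/-- The basis of `E` adapted to `g₀ ⊂ E`. -/
noncomputable def adaptedBasis {t : HolGerm z} (ht : 3 * t = 1) :
    Module.Basis (Fin 3) (HolGerm z) (E A) :=
  Module.Basis.ofEquivFun ((pi0Equiv A).trans (adaptedCoordR0 A ht))

section adaptedBasis

variable {t : HolGerm z} (ht : 3 * t = 1)

theorem adaptedBasis_repr (s : E A) : ⇑((adaptedBasis A ht).repr s) =
    ![-(3 * (s : Jet2 z) 0 1 + (A 0 1 + 2 * A 1 0) * (s : Jet2 z) 0 0
      - (A 2 0 - A 1 1) * (s : Jet2 z) 1 0), -(s : Jet2 z) 0 0, (s : Jet2 z) 1 0] :=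
  (adaptedBasis A ht).equivFun_apply s ▸ by rw [adaptedBasis, Module.Basis.equivFun_ofEquivFun]; rfl

theorem proj_adaptedBasis (j : Fin 3) : proj (adaptedBasis A ht j : Jet2 z) =
    ((adaptedCoordR0 A ht).symm (Pi.single j 1) : Jet1 z) := by
  have h : pi0Equiv A (adaptedBasis A ht j) = (adaptedCoordR0 A ht).symm (Pi.single j 1) := by
    simp [adaptedBasis]
  exact congrArg Subtype.val h

theorem adaptedBasis_b3 (j : Fin 3) : (adaptedBasis A ht j : Jet2 z) 0 0 = ![0, -1, 0] j := by
  have h := congrFun (congrFun (proj_adaptedBasis A ht j) 0) 0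
  simp [proj, adaptedCoordR0] at h
  rw [h]
  fin_cases j <;> simp

theorem adaptedBasis_b4 (j : Fin 3) : (adaptedBasis A ht j : Jet2 z) 1 0 = ![0, 0, 1] j := by
  have h := congrFun (congrFun (proj_adaptedBasis A ht j) 1) 0
  simp [proj, adaptedCoordR0] at h
  rw [h]
  fin_cases j <;> simp

theorem adaptedBasis_b3_x (j : Fin 3) : (adaptedBasis A ht j : Jet2 z) 0 1 =
    ![-t, t * (A 0 1 + 2 * A 1 0), t * (A 2 0 - A 1 1)] j := by
  have h := congrFun (congrFun (proj_adaptedBasis A ht j) 0) 1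
  simp [proj, adaptedCoordR0] at h
  rw [h]
  fin_cases j <;> simp

theorem toMatrix_curvature_adaptedBasis :
    LinearMap.toMatrix (adaptedBasis A ht) (adaptedBasis A ht) (curvature A) =
      !![traceCurvature A,
          dx (traceCurvature A) + linearizabilityL1 (linPoly A),
          dy (traceCurvature A) + linearizabilityL2 (linPoly A);
        0, 0, 0;
        0, 0, 0] := by
  refine Matrix.ext fun i j => ?_
  rw [LinearMap.toMatrix_apply, adaptedBasis_repr, curvature_b3_x, curvature_b3, curvature_b4,
    adaptedBasis_b3, adaptedBasis_b4, adaptedBasis_b3_x]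
  fin_cases i <;> fin_cases j <;>
    simp only [Fin.zero_eta, Fin.mk_one, Fin.reduceFinMk, Matrix.of_apply, Matrix.cons_val,
      neg_zero]
  · linear_combination traceCurvature A * ht
  · linear_combination -traceCurvature A * (A 0 1 + 2 * A 1 0) * ht
  · linear_combination -traceCurvature A * (A 2 0 - A 1 1) * ht

/-- Explicitly, `tr γ = (2 A₁₂ + A₂₁) dx + (2 A₃₁ + A₂₂) dy`. -/
theorem trace_gamma_adaptedBasis : traceCurvature A =
    dx (gammaY A (adaptedBasis A ht)).trace - dy (gammaX A (adaptedBasis A ht)).trace := by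
  have hx := derivation_eq_zero_of_three_mul ht dx
  have hy := derivation_eq_zero_of_three_mul ht dy
  have tX : (gammaX A (adaptedBasis A ht)).trace = 2 * A 0 1 + A 1 0 := by
    simp only [Matrix.trace_fin_three, gammaX, Matrix.of_apply, adaptedBasis_repr, nablaX_b3,
      nablaX_b4, nablaX_b3_x, coord_b3_xx, adaptedBasis_b3, adaptedBasis_b4, adaptedBasis_b3_x]
    simp [hx]
    linear_combination (A 0 1 + A 1 0) * ht
  have tY : (gammaY A (adaptedBasis A ht)).trace = 2 * A 2 0 + A 1 1 := by
    simp only [Matrix.trace_fin_three, gammaY, Matrix.of_apply, adaptedBasis_repr, nablaY_b3,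
      nablaY_b4, nablaY_b3_x, coord_b3_xy, adaptedBasis_b3, adaptedBasis_b4, adaptedBasis_b3_x]
    simp [hy]
    linear_combination A 2 0 * ht
  rw [tX, tY, traceCurvature]

end adaptedBasis

end Sys

/-! ### The linearization polynomial from the coefficients of the system. -/

theorem coeffDeriv_C {z : ℂ × ℂ} (D : Derivation ℤ (HolGerm z) (HolGerm z)) (c : HolGerm z) :
    coeffDeriv D (C c) = C (D c) := by
  ext1 n
  rw [coeffDeriv_coeff, coeff_C, coeff_C]
  split_ifs <;> simp

/-- Chain rule for the vector field `∂_x + q ∂_y` applied to `G(x, y, q(x, y))`. -/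
theorem eval_transport {z : ℂ × ℂ} (G : (HolGerm z)[X]) (q : HolGerm z) :
    (transport G).eval q + (derivative G).eval q * (dx q + q * dy q) =
      dx (G.eval q) + q * dy (G.eval q) := by
  have h : ∀ D : Derivation ℤ (HolGerm z) (HolGerm z),
      D (G.eval q) = (coeffDeriv D G).eval q + (derivative G).eval q * D q := by
    intro D
    induction G using Polynomial.induction_on' with
    | add G H hG hH =>
      simp only [eval_add, map_add, hG, hH]
      ring
    | monomial m a =>
      have : coeffDeriv D (monomial m a) = monomial m (D a) := by
        ext1 n
        rw [coeffDeriv_coeff, coeff_monomial, coeff_monomial]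
        split_ifs <;> simp
      rw [this]
      simp [derivative_monomial, Derivation.leibniz, Derivation.leibniz_pow]
      ring
  rw [h dx, h dy, transport]
  simp only [eval_add, eval_mul, eval_X]
  ring

namespace FourWeb

variable {z : ℂ × ℂ} (W : FourWeb z)

theorem rho_single_eq (j : Fin 2) : W.rho (Pi.single j 1) =
    C (W.A 2 j) * X ^ 2 + C (W.A 1 j) * X + C (W.A 0 j) := by
  have h := ((W.rho_eq_iff (Pi.single j 1) _).1 rfl).1
  ext1 n
  rcases lt_or_ge n 3 with hn | hn
  · interval_cases n <;> simp [A, coeff_X, coeff_C, coeff_X_pow]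
  · rw [coeff_eq_zero_of_natDegree_lt (h.trans_lt hn),
      coeff_eq_zero_of_natDegree_lt (natDegree_quadratic_le.trans_lt hn)]

theorem linPoly_eq : Sys.linPoly W.A = W.rho (Pi.single 0 1) - X * W.rho (Pi.single 1 1) := by
  rw [rho_single_eq, rho_single_eq, Sys.linPoly, Cubic.toPoly]
  simp only [map_sub, map_neg]
  ring

/-- Coprimality of `F` and `∂_p F`, one degree beyond `combination_unique`: the multiple of `F` that
removes the `p⁴` term of `V` reduces to that case, `a₀` being a unit. -/
theorem exists_eq_C_mul_of_mul_derivative_eq {V S : (HolGerm z)[X]} (hV : V.natDegree ≤ 4)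
    (hS : S.natDegree ≤ 3) (e : V * derivative W.F = S * W.F) :
    ∃ a, V = C a * W.F ∧ S = C a * derivative W.F := by
  have hdrop : ∀ {n : ℕ} {G : (HolGerm z)[X]}, G.natDegree ≤ n + 1 → G.coeff (n + 1) = 0 →
      G.natDegree ≤ n := by
    intro n G h h0
    refine natDegree_le_iff_coeff_eq_zero.2 fun N hN => ?_
    rcases eq_or_lt_of_le (Nat.succ_le_of_lt hN) with rfl | hN'
    · exact h0
    · exact coeff_eq_zero_of_natDegree_lt (h.trans_lt hN')
  obtain ⟨c, hc⟩ := W.isUnit_coeff_four.exists_left_inv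
  obtain ⟨V', hV'⟩ : ∃ V', V' = C (V.coeff 4 * c) * W.F - V := ⟨_, rfl⟩
  obtain ⟨S', hS'⟩ : ∃ S', S' = S - C (V.coeff 4 * c) * derivative W.F := ⟨_, rfl⟩
  have e' : S' * W.F + V' * derivative W.F = 0 := by
    rw [hS', hV']
    linear_combination -e
  have hVd : V'.natDegree ≤ 3 := by
    rw [hV']
    refine hdrop ((natDegree_sub_le _ _).trans
      (max_le ((natDegree_C_mul_le _ _).trans W.natDegree_le) hV)) ?_
    rw [coeff_sub, coeff_C_mul]
    linear_combination V.coeff 4 * hc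
  have hSd : S'.natDegree ≤ 2 := by
    have hS3 : S'.natDegree ≤ 3 := by
      rw [hS']
      exact (natDegree_sub_le _ _).trans
        (max_le hS ((natDegree_C_mul_le _ _).trans W.natDegree_derivative_le))
    refine hdrop hS3 ?_
    -- Since `V' ∂_p F` has degree at most 6, the coefficient of `p⁷` is that of `p³` in `S'` times
    -- `a₀`.
    have h7 : (S' * W.F + V' * derivative W.F).coeff (3 + 4) = 0 := by rw [e', coeff_zero]
    have hz : (V' * derivative W.F).coeff (3 + 4) = 0 := coeff_eq_zero_of_natDegree_lt
      ((natDegree_mul_le.trans (add_le_add hVd W.natDegree_derivative_le)).trans_lt (by norm_num))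
    rw [coeff_add, hz, add_zero, coeff_mul_add_eq_of_natDegree_le hS3 W.natDegree_le] at h7
    exact (W.isUnit_coeff_four.mul_left_eq_zero).1 h7
  obtain ⟨hS0, hV0⟩ := W.combination_unique hSd hVd e'
  exact ⟨V.coeff 4 * c, (sub_eq_zero.1 (hV'.symm.trans hV0)).symm,
    sub_eq_zero.1 (hS'.symm.trans hS0)⟩

theorem transport_add_mul_derivative : ∃ H : (HolGerm z)[X],
    transport W.F + Sys.linPoly W.A * derivative W.F = H * W.F := by
  obtain ⟨ht0, r0, hr0, e0⟩ := (W.rho_eq_iff (Pi.single 0 1) _).1 rfl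
  obtain ⟨ht1, r1, hr1, e1⟩ := (W.rho_eq_iff (Pi.single 1 1) _).1 rfl
  have t1 : transport (1 : (HolGerm z)[X]) = 0 := by
    rw [← C_1, transport, coeffDeriv_C, coeffDeriv_C]
    simp
  have tX : transport (X : (HolGerm z)[X]) = 0 := by
    have h : ∀ D, coeffDeriv D (X : (HolGerm z)[X]) = 0 := by
      intro D
      ext1 n
      rw [coeffDeriv_coeff, coeff_X]
      split_ifs <;> simp
    rw [transport, h, h]
    simp
  simp [t1, tX] at e0 e1
  have hXmul : ∀ {n : ℕ} {G : (HolGerm z)[X]}, G.natDegree ≤ n → (X * G).natDegree ≤ n + 1 :=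
    fun {n G} h => natDegree_mul_le.trans (by
      have := natDegree_X_le (R := HolGerm z)
      lia)
  have hV : (X * r1 - r0).natDegree ≤ 4 :=
    (natDegree_sub_le _ _).trans (max_le (hXmul hr1) (hr0.trans (by norm_num)))
  have hd : derivative (X * r1 - r0) = r1 + X * derivative r1 - derivative r0 := by simp
  have hS : (derivative (X * r1 - r0) - r1 + W.rho (Pi.single 0 1)
      - X * W.rho (Pi.single 1 1)).natDegree ≤ 3 := by
    refine (natDegree_sub_le _ _).trans (max_le ((natDegree_add_le _ _).trans
      (max_le ((natDegree_sub_le _ _).trans (max_le ?_ hr1)) (ht0.trans (by norm_num)))) (hXmul ht1))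
    exact (Polynomial.natDegree_derivative_le _).trans (Nat.sub_le_sub_right hV 1)
  -- `p` times the relation for `r = 1`, minus the one for `r = p`, eliminates `∂_x F + p ∂_y F`.
  obtain ⟨a, hVa, hSa⟩ := W.exists_eq_C_mul_of_mul_derivative_eq hV hS (by
    rw [hd]
    linear_combination X * e1 - e0)
  rw [hVa, derivative_C_mul] at hSa
  -- The terms `a ∂_p F` on the two sides of `hSa` cancel, leaving `r1 = ρ(p) - p ρ(1)`.
  have hr1 : Sys.linPoly W.A = r1 := by
    rw [linPoly_eq]
    linear_combination hSa
  exact ⟨derivative r1 - W.rho (Pi.single 1 1), by rw [hr1]; exact e1⟩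

theorem isLinearizationPolynomial_linPoly : W.IsLinearizationPolynomial (Sys.linPoly W.A) := by
  refine ⟨natDegree_cubic_le, fun q hq => ?_⟩
  obtain ⟨H, hH⟩ := W.transport_add_mul_derivative
  have h := congrArg (eval q) hH
  have ht := eval_transport W.F q
  simp only [eval_add, eval_mul, hq, mul_zero, map_zero, add_zero] at h ht
  refine (W.isUnit_eval_derivative hq).mul_left_cancel ?_
  linear_combination ht - h

theorem existsUnique_isLinearizationPolynomial :
    ∃! P : (HolGerm z)[X], W.IsLinearizationPolynomial P := by
  refine ⟨_, W.isLinearizationPolynomial_linPoly, fun P hP => ?_⟩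
  have hL := W.isLinearizationPolynomial_linPoly
  exact W.eq_of_eval_eq hP.1 hL.1 fun q hq => (hP.2 q hq).symm.trans (hL.2 q hq)

/-! ## Change of the equation of the web -/

theorem transport_C_mul (g : HolGerm z) (G : (HolGerm z)[X]) :
    transport (C g * G) = C g * transport G + transport (C g) * G := by
  have h : ∀ D : Derivation ℤ (HolGerm z) (HolGerm z),
      coeffDeriv D (C g * G) = C g * coeffDeriv D G + coeffDeriv D (C g) * G := by
    intro D
    rw [coeffDeriv_C]
    ext1 n
    simp only [coeffDeriv_coeff, coeff_add, coeff_C_mul, Derivation.leibniz, smul_eq_mul]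
    ring
  rw [transport, transport, transport, h, h]
  ring

/-- On the surface `F = 0`, `∂_p (gF) = g ∂_p F`, so the numerator `g r` defines the same `ω`; the
numerator of `dω` is therefore multiplied by `g`. -/
theorem rescale_rho (g : (HolGerm z)ˣ) (b : Fin 2 → HolGerm z) :
    (W.rescale g).rho (fun k => g * b k) = C (g : HolGerm z) * W.rho b := by
  obtain ⟨ht, rp, hrp, e⟩ := (W.rho_eq_iff b _).1 rfl
  refine ((W.rescale g).rho_eq_iff _ _).2 ⟨(natDegree_C_mul_le _ _).trans ht, C (g : HolGerm z) * rp,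
    (natDegree_C_mul_le _ _).trans hrp, ?_⟩
  have hr : C ((g : HolGerm z) * b 0) * X + C ((g : HolGerm z) * b 1) =
      C (g : HolGerm z) * (C (b 0) * X + C (b 1)) := by
    simp only [map_mul]
    ring
  have hF : (W.rescale g).F = C (g : HolGerm z) * W.F := rfl
  rw [hr, hF, transport_C_mul _ W.F, transport_C_mul _ (C (b 0) * X + C (b 1)), derivative_C_mul,
    derivative_C_mul]
  linear_combination C (g : HolGerm z) ^ 2 * e

/-- Compare zeroth order terms in `rescale_rho`: the derivatives of `g` come from the Leibniz rule
in the first order part. -/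
theorem rescale_A (g : (HolGerm z)ˣ) (i : Fin 3) :
    g * (W.rescale g).A i 0 = g * W.A i 0 - ![0, dx (g : HolGerm z), dy (g : HolGerm z)] i ∧
    g * (W.rescale g).A i 1 = g * W.A i 1 - ![dx (g : HolGerm z), dy (g : HolGerm z), 0] i := by
  constructor
  · have h := (W.rescale g).rho_coeff (fun k => g * (Pi.single 0 1 : Fin 2 → HolGerm z) k) i
    rw [rescale_rho, coeff_C_mul, W.rho_coeff] at h
    fin_cases i <;> simp [-Units.mul_right_inj] at h ⊢ <;> linear_combination -h
  · have h := (W.rescale g).rho_coeff (fun k => g * (Pi.single 1 1 : Fin 2 → HolGerm z) k) i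
    rw [rescale_rho, coeff_C_mul, W.rho_coeff] at h
    fin_cases i <;> simp [-Units.mul_right_inj] at h ⊢ <;> linear_combination -h

end FourWeb

/-! ### Multiplication of jets by a germ as a gauge transformation. -/

namespace Jet2

variable {z : ℂ × ℂ}

theorem mulGerm_add (g : HolGerm z) (u v : Jet2 z) :
    mulGerm g (u + v) = mulGerm g u + mulGerm g v := by
  refine funext fun k => funext fun i => ?_
  fin_cases i <;> simp [mulGerm] <;> ring

theorem mulGerm_smul (g c : HolGerm z) (u : Jet2 z) : mulGerm g (c • u) = c • mulGerm g u := by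
  refine funext fun k => funext fun i => ?_
  fin_cases i <;> simp [mulGerm] <;> ring

theorem mulGerm_mul (g h : HolGerm z) (u : Jet2 z) :
    mulGerm (g * h) u = mulGerm g (mulGerm h u) := by
  refine funext fun k => funext fun i => ?_
  fin_cases i <;> simp [mulGerm, dx_dy] <;> ring

theorem mulGerm_one (u : Jet2 z) : mulGerm 1 u = u := by
  refine funext fun k => funext fun i => ?_
  fin_cases i <;> simp [mulGerm]

end Jet2

namespace Sys

open Jet2

variable {z : ℂ × ℂ} {A B : Matrix (Fin 3) (Fin 2) (HolGerm z)} {g : HolGerm z}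

/-- The relation between the matrices `A` and `B` of two systems which says that the solutions of
the second one are the products by `g` of the solutions of the first one. -/
def IsGauge (g : HolGerm z) (A B : Matrix (Fin 3) (Fin 2) (HolGerm z)) : Prop :=
  ∀ i, g * B i 0 = g * A i 0 - ![0, dx g, dy g] i ∧ g * B i 1 = g * A i 1 - ![dx g, dy g, 0] i

theorem IsGauge.p0_mulGerm (h : IsGauge g A B) (u : Jet2 z) (i : Fin 3) :
    p0 B (proj (mulGerm g u)) i = g * p0 A (proj u) i := by
  obtain ⟨h0, h1⟩ := h i
  fin_cases i <;> simp [p0, proj, mulGerm] at h0 h1 ⊢ <;>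
    linear_combination u 0 0 * h0 + u 1 0 * h1

/-- The formal `x`-derivative of `IsGauge.p0_mulGerm`; the last term is harmless on `E`, where `p0`
vanishes. -/
theorem IsGauge.prolong_x_mulGerm (h : IsGauge g A B) (u : Jet2 z) (i : Fin 3) :
    p0 B (shiftX (mulGerm g u)) i +
        (dx (B i 0) * mulGerm g u 0 0 + dx (B i 1) * mulGerm g u 1 0) =
      g * (p0 A (shiftX u) i + (dx (A i 0) * u 0 0 + dx (A i 1) * u 1 0)) +
        dx g * p0 A (proj u) i := by
  obtain ⟨h0, h1⟩ := h i
  have h0' := congrArg dx h0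
  have h1' := congrArg dx h1
  fin_cases i <;> simp [p0, proj, shiftX, mulGerm, dx_dy] at h0 h1 h0' h1' ⊢ <;>
    linear_combination u 0 1 * h0 + u 1 1 * h1 + u 0 0 * h0' + u 1 0 * h1'

theorem IsGauge.prolong_y_mulGerm (h : IsGauge g A B) (u : Jet2 z) (i : Fin 3) :
    p0 B (shiftY (mulGerm g u)) i +
        (dy (B i 0) * mulGerm g u 0 0 + dy (B i 1) * mulGerm g u 1 0) =
      g * (p0 A (shiftY u) i + (dy (A i 0) * u 0 0 + dy (A i 1) * u 1 0)) +
        dy g * p0 A (proj u) i := by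
  obtain ⟨h0, h1⟩ := h i
  have h0' := congrArg dy h0
  have h1' := congrArg dy h1
  fin_cases i <;> simp [p0, proj, shiftY, mulGerm, dx_dy] at h0 h1 h0' h1' ⊢ <;>
    linear_combination u 0 2 * h0 + u 1 2 * h1 + u 0 0 * h0' + u 1 0 * h1'

theorem IsGauge.mulGerm_mem_iff (h : IsGauge g A B) (hg : IsUnit g) {u : Jet2 z} :
    mulGerm g u ∈ E B ↔ u ∈ E A := by
  have h0 : p0 B (proj (mulGerm g u)) = 0 ↔ p0 A (proj u) = 0 := by
    simp only [funext_iff, h.p0_mulGerm, Pi.zero_apply, hg.mul_right_eq_zero]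
  rw [mem_E, mem_E, h0]
  refine and_congr_right fun e => ?_
  simp only [h.prolong_x_mulGerm, h.prolong_y_mulGerm, e, Pi.zero_apply, mul_zero, add_zero,
    hg.mul_right_eq_zero]

/-- Multiplication of `2`-jets by an invertible germ. -/
noncomputable def IsGauge.equiv {g : (HolGerm z)ˣ} (h : IsGauge (g : HolGerm z) A B) :
    E A ≃ₗ[HolGerm z] E B where
  toFun s := ⟨mulGerm g s, (h.mulGerm_mem_iff g.isUnit).2 s.2⟩
  map_add' s t := Subtype.ext (mulGerm_add _ _ _)
  map_smul' c s := Subtype.ext (mulGerm_smul _ _ _)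
  invFun s := ⟨mulGerm (↑g⁻¹ : HolGerm z) s, (h.mulGerm_mem_iff g.isUnit).1 (by
    rw [← mulGerm_mul, Units.mul_inv, mulGerm_one]
    exact s.2)⟩
  left_inv s := Subtype.ext (by
    change mulGerm _ (mulGerm _ _) = _
    rw [← mulGerm_mul, Units.inv_mul, mulGerm_one])
  right_inv s := Subtype.ext (by
    change mulGerm _ (mulGerm _ _) = _
    rw [← mulGerm_mul, Units.mul_inv, mulGerm_one])

theorem IsGauge.coe_equiv {g : (HolGerm z)ˣ} (h : IsGauge (g : HolGerm z) A B) (s : E A) :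
    (h.equiv s : Jet2 z) = mulGerm g s := rfl

/-- The Spencer operator vanishes on the 2-jet of `g`, so by the Leibniz rule `D(j²(g) u) = j¹(g)
D(u)`. -/
theorem IsGauge.nablaX_equiv {g : (HolGerm z)ˣ} (h : IsGauge (g : HolGerm z) A B) (s : E A) :
    nablaX B (h.equiv s) = h.equiv (nablaX A s) := by
  refine (pi0Equiv B).injective (((pi0Equiv B).apply_symm_apply _).trans (Subtype.ext ?_))
  have e : ∀ k i, proj (nablaX A s : Jet2 z) k i = spencerX (s : Jet2 z) k i := fun k i => by
    rw [proj_nablaX]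
  change spencerX (mulGerm g s) = proj (mulGerm g (nablaX A s : Jet2 z))
  refine funext fun k => funext fun i => ?_
  have e0 := e k 0
  have e1 := e k 1
  have e2 := e k 2
  simp only [proj, spencerX, shiftX, LinearMap.coe_mk, AddHom.coe_mk, Matrix.cons_val] at e0 e1 e2
  fin_cases i <;>
    simp [proj, spencerX, shiftX, mulGerm, e0, e1, e2, dx_dy] <;> ring

theorem IsGauge.nablaY_equiv {g : (HolGerm z)ˣ} (h : IsGauge (g : HolGerm z) A B) (s : E A) :
    nablaY B (h.equiv s) = h.equiv (nablaY A s) := by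
  refine (pi0Equiv B).injective (((pi0Equiv B).apply_symm_apply _).trans (Subtype.ext ?_))
  have e : ∀ k i, proj (nablaY A s : Jet2 z) k i = spencerY (s : Jet2 z) k i := fun k i => by
    rw [proj_nablaY]
  change spencerY (mulGerm g s) = proj (mulGerm g (nablaY A s : Jet2 z))
  refine funext fun k => funext fun i => ?_
  have e0 := e k 0
  have e1 := e k 1
  have e2 := e k 2
  simp only [proj, spencerY, shiftY, LinearMap.coe_mk, AddHom.coe_mk, Matrix.cons_val] at e0 e1 e2
  fin_cases i <;>
    simp [proj, spencerY, shiftY, mulGerm, e0, e1, e2, dx_dy] <;> ring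

theorem IsGauge.curvature_equiv {g : (HolGerm z)ˣ} (h : IsGauge (g : HolGerm z) A B) (s : E A) :
    curvature B (h.equiv s) = h.equiv (curvature A s) := by
  change nablaX B (nablaY B (h.equiv s)) - nablaY B (nablaX B (h.equiv s)) =
    h.equiv (nablaX A (nablaY A s) - nablaY A (nablaX A s))
  rw [map_sub, h.nablaX_equiv, h.nablaY_equiv, h.nablaY_equiv, h.nablaX_equiv]

theorem IsGauge.toMatrix_curvature {g : (HolGerm z)ˣ} (h : IsGauge (g : HolGerm z) A B)
    (b : Module.Basis (Fin 3) (HolGerm z) (E A)) :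
    LinearMap.toMatrix (b.map h.equiv) (b.map h.equiv) (curvature B) =
      LinearMap.toMatrix b b (curvature A) := by
  refine Matrix.ext fun i j => ?_
  rw [LinearMap.toMatrix_apply, LinearMap.toMatrix_apply, Module.Basis.map_apply,
    h.curvature_equiv, Module.Basis.map_repr]
  simp

end Sys

/-- The linearization polynomial exists and is unique, the curvature matrix of the connection
associated with a `4`-web has the stated form in a basis adapted to `g₀ ⊂ E`, and it is the same
for all equations `g F = 0` with `g` invertible, under the multiplication of jets by `g`. -/
theorem mainTheorem4 {z : ℂ × ℂ} (W : FourWeb z) :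
    (∃! P : (HolGerm z)[X], W.IsLinearizationPolynomial P) ∧
    ∀ P : (HolGerm z)[X], W.IsLinearizationPolynomial P →
      ∃ b : Module.Basis (Fin 3) (HolGerm z) W.bundle,
        (∀ k, (b 0 : Jet2 z) k 0 = 0) ∧
        ((b 1 : Jet2 z) 0 0 = -1 ∧ (b 1 : Jet2 z) 1 0 = 0) ∧
        ((b 2 : Jet2 z) 0 0 = 0 ∧ (b 2 : Jet2 z) 1 0 = 1) ∧
        (∃ k₁ : HolGerm z,
          k₁ = dx (Sys.gammaY W.A b).trace - dy (Sys.gammaX W.A b).trace ∧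
          LinearMap.toMatrix b b W.curvature =
            !![k₁, dx k₁ + linearizabilityL1 P, dy k₁ + linearizabilityL2 P;
               0, 0, 0;
               0, 0, 0]) ∧
        ∀ g : (HolGerm z)ˣ, ∃ Φ : W.bundle ≃ₗ[HolGerm z] (W.rescale g).bundle,
          (∀ s : W.bundle, (Φ s : Jet2 z) = Jet2.mulGerm g s) ∧
          LinearMap.toMatrix (b.map Φ) (b.map Φ) (W.rescale g).curvature =
            LinearMap.toMatrix b b W.curvature := by
  obtain ⟨t, ht⟩ := Sys.exists_three_mul_eq_one (z := z)
  refine ⟨W.existsUnique_isLinearizationPolynomial, fun P hP => ?_⟩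
  obtain rfl : P = Sys.linPoly W.A :=
    W.existsUnique_isLinearizationPolynomial.unique hP W.isLinearizationPolynomial_linPoly
  refine ⟨Sys.adaptedBasis W.A ht, fun k => ?_, ⟨Sys.adaptedBasis_b3 W.A ht 1,
    Sys.adaptedBasis_b4 W.A ht 1⟩, ⟨Sys.adaptedBasis_b3 W.A ht 2, Sys.adaptedBasis_b4 W.A ht 2⟩,
    ⟨Sys.traceCurvature W.A, Sys.trace_gamma_adaptedBasis W.A ht,
      Sys.toMatrix_curvature_adaptedBasis W.A ht⟩, fun g => ?_⟩
  · fin_cases k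
    · exact Sys.adaptedBasis_b3 W.A ht 0
    · exact Sys.adaptedBasis_b4 W.A ht 0
  · have h : Sys.IsGauge (g : HolGerm z) W.A (W.rescale g).A := W.rescale_A g
    exact ⟨h.equiv, h.coe_equiv, h.toMatrix_curvature _⟩
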